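/- Let $\{B_0(t),t\in\mathbb R_+\}$ be a real-valued centered Gaussian process with continuous paths, with canonical metric $\delta(s,t)=\big(\mathbb E(B_0(s)-B_0(t))^2\big)^{1/2}$. Let $\gamma:\mathbb R_+\to\mathbb R_+$ satisfy $\gamma(0)=0$ and $\gamma(x)>0$ for $x>0$, and let $\gamma$ be continuous and strictly increasing on $[0,x_0]$ for some $x_0>0$ (for instance, $\gamma$ continuous and strictly increasing on $\mathbb R_+$ with $\lim_0\gamma=0$). Assume that for some constant $l\ge 1$ and all $s,t\in\mathbb R_+$, $$\mathbb E\,B_0(t)^2=\gamma^2(t)\quad\text{and}\quad \tfrac1{\sqrt l}\,\gamma(|t-s|)\le\delta(t,s)\le\sqrt l\,\gamma(|t-s|).$$ Let $B=(B_1,\dots,B_d)$, where $B_1,\dots,B_d$ are independent copies of $B_0$ with continuous paths. Write $B_\delta(t,r)=\{s\in\mathbb R_+:\delta(s,t)\le r\}$, let $\|\cdot\|$ be the Euclidean norm on $\mathbb R^d$, and for small $r>0$ put $$f_\gamma(r):=r\sqrt{\log 2}+\int_0^{1/2}\gamma\big(\gamma^{-1}(r\sqrt l)\,y\big)\frac{dy}{y\sqrt{\log(1/y)}}\in[0,\infty],$$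 where $\gamma^{-1}$ is the inverse of $\gamma$ near $0$. Let $0<a<b<\infty$ and $I=[a,b]$. Then for every $M>0$ there are constants $c_2,r_0>0$ such that for all $r\in(0,r_0)$, $t\in I$ and $z\in[-M,M]^d$, $$\mathbb P\Big\{\inf_{s\in B_\delta(t,r)\cap I}\|B(s)-z\|\le r\Big\}\le c_2\,\big(r+f_\gamma(r)\big)^d .$$ -/

import Mathlib

open MeasureTheory ProbabilityTheory Set Filter Topology
open scoped NNReal ENNReal

noncomputable section

namespace GaussianHitting

/-- The canonical (pseudo-)metric `δ(s, t) = (𝔼 (X s - X t)²)^{1/2}` of a real process `X`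
indexed by `ℝ₊`. -/
def canonicalMetric {Ω : Type*} [MeasurableSpace Ω] (X : ℝ≥0 → Ω → ℝ) (P : Measure Ω)
    (s t : ℝ≥0) : ℝ :=
  Real.sqrt (∫ ω, (X s ω - X t ω) ^ 2 ∂P)

/-- The closed ball `{s ∈ ℝ₊ : δ(s, t) ≤ r}`. -/
def deltaBall (δ : ℝ≥0 → ℝ≥0 → ℝ) (t : ℝ≥0) (r : ℝ) : Set ℝ≥0 :=
  {s | δ s t ≤ r}

/-- A real valued centered continuous Gaussian process indexed by `ℝ₊`. -/
structure IsCenteredContinuousGaussian {Ω : Type*} [MeasurableSpace Ω]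
    (X : ℝ≥0 → Ω → ℝ) (P : Measure Ω) : Prop where
  measurable : ∀ t, Measurable (X t)
  gaussian : IsGaussianProcess X P
  centered : ∀ t, ∫ ω, X t ω ∂P = 0
  continuous : ∀ᵐ ω ∂P, Continuous fun t => X t ω

/-- The conditions on `γ : ℝ₊ → ℝ₊` (only the values of `γ` on `[0, ∞)` matter): `γ` vanishes at
`0` and only there, and it is continuous and strictly increasing in a neighbourhood of `0` in `ℝ₊`.
Every continuous strictly increasing function on `ℝ₊` with limit `0` at `0` satisfies them. -/
structure IsScale (γ : ℝ → ℝ) : Prop where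
  map_zero : γ 0 = 0
  pos : ∀ x, 0 < x → 0 < γ x
  near_zero : ∃ x₀ > 0, ContinuousOn γ (Icc 0 x₀) ∧ StrictMonoOn γ (Icc 0 x₀)

/-- The process `X` has variance `γ²`, and its canonical metric is commensurate with
`γ(|t - s|)`, with constant `√l`. -/
structure IsCommensurate {Ω : Type*} [MeasurableSpace Ω] (γ : ℝ → ℝ) (l : ℝ)
    (X : ℝ≥0 → Ω → ℝ) (P : Measure Ω) : Prop where
  variance : ∀ t : ℝ≥0, ∫ ω, X t ω ^ 2 ∂P = γ t ^ 2
  lower : ∀ s t : ℝ≥0, 1 / Real.sqrt l * γ |(t : ℝ) - s| ≤ canonicalMetric X P t s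
  upper : ∀ s t : ℝ≥0, canonicalMetric X P t s ≤ Real.sqrt l * γ |(t : ℝ) - s|

/-- The processes `B i`, `i : Fin d`, are independent copies of the process `B₀`: they have the
law of `B₀` on path space, continuous paths, and are mutually independent as processes. -/
structure AreIndepCopies {Ω₀ Ω : Type*} [MeasurableSpace Ω₀] [MeasurableSpace Ω] {d : ℕ}
    (B : Fin d → ℝ≥0 → Ω → ℝ) (P : Measure Ω) (B₀ : ℝ≥0 → Ω₀ → ℝ) (P₀ : Measure Ω₀) : Prop where
  measurable : ∀ i t, Measurable (B i t)
  continuous : ∀ i, ∀ᵐ ω ∂P, Continuous fun t => B i t ω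
  identDistrib : ∀ i, IdentDistrib (fun ω t => B i t ω) (fun ω t => B₀ t ω) P P₀
  indep : iIndepFun (fun i ω t => B i t ω) P

/-- The `ℝ^d`-valued process with coordinates `B i`; `ℝ^d` carries the Euclidean norm. -/
def pathVector {Ω : Type*} {d : ℕ} (B : Fin d → ℝ≥0 → Ω → ℝ) (t : ℝ≥0) (ω : Ω) :
    EuclideanSpace ℝ (Fin d) :=
  WithLp.toLp 2 fun i => B i t ω

/-- The inverse `γ⁻¹(u)`: the solution `x ≥ 0` of `γ x = u`. If `γ` is increasing only near `0`,
then the least solution is, for small `u ≥ 0`, the inverse of `γ` near `0`. -/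
def scaleInv (γ : ℝ → ℝ) (u : ℝ) : ℝ :=
  sInf {x | 0 ≤ x ∧ γ x = u}

/-- `f_γ(r) = r √(log 2) + ∫₀^{1/2} γ(γ⁻¹(r √l) y) dy / (y √(log (1/y)))`. The integrand is
nonnegative, so the integral is taken in `[0, ∞]`. -/
def entropyBound (γ : ℝ → ℝ) (l r : ℝ) : ℝ≥0∞ :=
  ENNReal.ofReal (r * Real.sqrt (Real.log 2)) +
    ∫⁻ y in Ioo (0 : ℝ) (1 / 2),
      ENNReal.ofReal (γ (scaleInv γ (r * Real.sqrt l) * y) / (y * Real.sqrt (Real.log (1 / y))))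

end GaussianHitting

end

/-!
Write `h = γ⁻¹(r √l)`. For small `r`, the points of `I` in the `δ`-ball of radius `r` about `t`
lie in `[t - h, t + h]`, because `γ` is bounded below away from `0`. If the infimum of
`‖B(s) - z‖` over these points is at most `r`, then every coordinate of the path comes within `2r`
of the corresponding coordinate of `z`, and, by continuity, does so at one of countably many times
`t ± h x`, where `x` runs over the grid points `j / 2 ^ 2 ^ k` of `[0, 1]`. As the coordinates are
independent copies of `B₀`, it is enough to bound the probability of this event for `B₀` by a
multiple of `r + f_γ(r)`; the `d`-th power comes from the product over the coordinates.

For one coordinate, put `X x = B₀ (t ± h x)` and decompose `X x = c x * X 0 + R x`, where `R` is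
independent of `X 0` (`indepFun_regression_residual`) and `|1 - c x|` is of order `r`. If `X`
comes close to `z`, then `|X 0 - z|` is at most a multiple of `r + sup |R|`. Since `X 0 = B₀ t`
has a density which is bounded uniformly in `t ∈ I`, this has probability of order `r + 𝔼 sup |R|`
(`measure_abs_sub_le_of_indepFun`), and `𝔼 sup |R|` exceeds `𝔼 sup |X x - X 0|` by at most `l r`.

The oscillation `𝔼 sup |X x - X 0|` is bounded by chaining along the grids of mesh `2 ^ (-2 ^ k)`.
The `k`-th step is a maximum of at most `2 exp (2 ^ (k + 1))` Gaussian variables of standard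
deviation at most `√l γ(h 2 ^ (-2 ^ k))`, and so costs a multiple of
`2 ^ (k / 2) γ(h 2 ^ (-2 ^ k))` (`lintegral_iSup_abs_le`, `lintegral_iSup_gridPoints_le`). As
`dy / (y √(log (1 / y)))` has mass of order `2 ^ (k / 2)` on each interval
`(2 ^ (-2 ^ (k + 1)), 2 ^ (-2 ^ k))`, the sum of these costs is at most a multiple of `f_γ(r)`
(`tsum_grid_le_lintegral`). All suprema and integrals are taken in `[0, ∞]`, so a divergent
entropy integral needs no separate treatment.
-/

namespace GaussianHitting

/-! ### Maxima of Gaussian variables -/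

lemma lintegral_exp_mul_le_of_hasGaussianLaw {Ω : Type*} [MeasurableSpace Ω] {P : Measure Ω}
    {G : Ω → ℝ} (hG : HasGaussianLaw G P) (h0 : ∫ ω, G ω ∂P = 0) {s : ℝ}
    (hs : ∫ ω, G ω ^ 2 ∂P ≤ s ^ 2) (u : ℝ) :
    ∫⁻ ω, ENNReal.ofReal (Real.exp (u * G ω)) ∂P
      ≤ ENNReal.ofReal (Real.exp (u ^ 2 * s ^ 2 / 2)) := by
  have hvar : Var[G; P] = ∫ ω, G ω ^ 2 ∂P := by
    rw [variance_of_integral_eq_zero hG.aemeasurable h0]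
  have hmap := hG.map_eq_gaussianReal
  rw [h0] at hmap
  have e : ∫⁻ ω, ENNReal.ofReal (Real.exp (u * G ω)) ∂P
      = ∫⁻ x, ENNReal.ofReal (Real.exp (u * x)) ∂(P.map G) :=
    (lintegral_map' (f := fun x => ENNReal.ofReal (Real.exp (u * x)))
      (by fun_prop) hG.aemeasurable).symm
  rw [e, hmap, ← ofReal_integral_eq_lintegral_ofReal (integrable_exp_mul_gaussianReal u)
    (ae_of_all _ fun x => (Real.exp_pos _).le)]
  apply ENNReal.ofReal_le_ofReal
  have := (mgf_gaussianReal (X := id) (p := gaussianReal 0 Var[G; P].toNNReal)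
    (μ := 0) (v := Var[G; P].toNNReal) (by simp)) u
  simp only [mgf, id] at this
  rw [this, Real.exp_le_exp, Real.coe_toNNReal _ (variance_nonneg _ _), hvar]
  nlinarith [mul_le_mul_of_nonneg_left hs (sq_nonneg u)]

/-- The expected maximum of at most `2 exp (θ²)` centered Gaussian variables of standard deviation
at most `s` is of order `θ s`. The variables may be dependent. -/
lemma lintegral_iSup_abs_le {Ω ι : Type*} [MeasurableSpace Ω] {P : Measure Ω}
    [IsProbabilityMeasure P] [Fintype ι] {G : ι → Ω → ℝ} (hG : ∀ i, HasGaussianLaw (G i) P)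
    (h0 : ∀ i, ∫ ω, G i ω ∂P = 0) {s θ : ℝ} (hvar : ∀ i, ∫ ω, G i ω ^ 2 ∂P ≤ s ^ 2)
    (hs : 0 < s) (hθ : 1 ≤ θ) (hcard : (Fintype.card ι : ℝ) ≤ 2 * Real.exp (θ ^ 2)) :
    ∫⁻ ω, ⨆ i, ENNReal.ofReal |G i ω| ∂P ≤ ENNReal.ofReal (6 * θ * s) := by
  have hθ0 : 0 < θ := by linarith
  set u := θ / s with hu
  set A := s / θ * Real.exp (-(2 * θ ^ 2)) with hA
  have hA0 : 0 ≤ A := by positivity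
  -- `x ≤ 2θ² + exp (x - 2θ²)` for `x = u |G i|`: the factor `exp (-2θ²)` absorbs both the number
  -- of variables and their exponential moments `exp (θ² / 2)`.
  have hpt : ∀ ω, ⨆ i, ENNReal.ofReal |G i ω| ≤ ENNReal.ofReal (2 * θ * s) +
      ∑ j, ENNReal.ofReal A * (ENNReal.ofReal (Real.exp (u * G j ω)) +
        ENNReal.ofReal (Real.exp (-u * G j ω))) := by
    intro ω
    refine iSup_le fun i => ?_
    have h1 : |G i ω| ≤ 2 * θ * s +
        A * (Real.exp (u * G i ω) + Real.exp (-u * G i ω)) := by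
      have h2 : u * |G i ω| - 2 * θ ^ 2 ≤ Real.exp (u * |G i ω| - 2 * θ ^ 2) := by
        linarith [Real.add_one_le_exp (u * |G i ω| - 2 * θ ^ 2)]
      have h3 : Real.exp (u * |G i ω|) ≤ Real.exp (u * G i ω) + Real.exp (-u * G i ω) := by
        rcases abs_cases (G i ω) with ⟨h, _⟩ | ⟨h, _⟩
        · rw [h]; linarith [Real.exp_pos (-u * G i ω)]
        · rw [h, mul_neg, ← neg_mul]; linarith [Real.exp_pos (u * G i ω)]
      have h4 : s / θ * (u * |G i ω| - 2 * θ ^ 2) ≤ A * Real.exp (u * |G i ω|) := by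
        rw [hA, mul_assoc, ← Real.exp_add]
        refine (mul_le_mul_of_nonneg_left h2 (by positivity)).trans (le_of_eq ?_)
        ring_nf
      have h5 : s / θ * (u * |G i ω| - 2 * θ ^ 2) = |G i ω| - 2 * θ * s := by
        rw [hu]; field_simp
      nlinarith [mul_le_mul_of_nonneg_left h3 hA0]
    calc ENNReal.ofReal |G i ω|
        ≤ ENNReal.ofReal (2 * θ * s +
            A * (Real.exp (u * G i ω) + Real.exp (-u * G i ω))) := ENNReal.ofReal_le_ofReal h1
      _ = ENNReal.ofReal (2 * θ * s) + ENNReal.ofReal A *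
          (ENNReal.ofReal (Real.exp (u * G i ω)) + ENNReal.ofReal (Real.exp (-u * G i ω))) := by
        rw [ENNReal.ofReal_add (by positivity) (by positivity), ENNReal.ofReal_mul hA0,
          ENNReal.ofReal_add (by positivity) (by positivity)]
      _ ≤ _ := by
        gcongr
        exact Finset.single_le_sum (f := fun j => ENNReal.ofReal A *
          (ENNReal.ofReal (Real.exp (u * G j ω)) + ENNReal.ofReal (Real.exp (-u * G j ω))))
          (fun _ _ => zero_le) (Finset.mem_univ i)
  have hm : ∀ i, AEMeasurable (G i) P := fun i => (hG i).aemeasurable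
  have hme : ∀ i (v : ℝ), AEMeasurable (fun ω => ENNReal.ofReal (Real.exp (v * G i ω))) P :=
    fun i v => by have := hm i; fun_prop
  have hme' : ∀ i, AEMeasurable (fun ω => ENNReal.ofReal (Real.exp (u * G i ω)) +
      ENNReal.ofReal (Real.exp (-u * G i ω))) P := fun i => (hme i u).add (hme i (-u))
  have hE : ∀ i, ∫⁻ ω, ENNReal.ofReal A * (ENNReal.ofReal (Real.exp (u * G i ω)) +
        ENNReal.ofReal (Real.exp (-u * G i ω))) ∂P ≤
        ENNReal.ofReal (A * (2 * Real.exp (θ ^ 2 / 2))) := by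
    intro i
    have e : u ^ 2 * s ^ 2 = θ ^ 2 := by rw [hu]; field_simp
    rw [lintegral_const_mul'' _ (hme' i), lintegral_add_left' (hme i u),
      ENNReal.ofReal_mul hA0, two_mul, ENNReal.ofReal_add (by positivity) (by positivity)]
    gcongr
    · simpa [e] using lintegral_exp_mul_le_of_hasGaussianLaw (hG i) (h0 i) (hvar i) u
    · simpa [e] using lintegral_exp_mul_le_of_hasGaussianLaw (hG i) (h0 i) (hvar i) (-u)
  calc ∫⁻ ω, ⨆ i, ENNReal.ofReal |G i ω| ∂P
      ≤ ∫⁻ ω, (ENNReal.ofReal (2 * θ * s) +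
      ∑ j, ENNReal.ofReal A * (ENNReal.ofReal (Real.exp (u * G j ω)) +
        ENNReal.ofReal (Real.exp (-u * G j ω)))) ∂P := lintegral_mono hpt
    _ ≤ ENNReal.ofReal (2 * θ * s) +
        ∑ j : ι, ENNReal.ofReal (A * (2 * Real.exp (θ ^ 2 / 2))) := by
      rw [lintegral_add_left measurable_const, lintegral_finsetSum' _
        fun i _ => (hme' i).const_mul _]
      simp only [lintegral_const, measure_univ, mul_one]
      gcongr with i
      exact hE i
    _ = ENNReal.ofReal (2 * θ * s + Fintype.card ι * (A * (2 * Real.exp (θ ^ 2 / 2)))) := by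
      rw [ENNReal.ofReal_add (by positivity) (by positivity), ENNReal.ofReal_mul (by positivity)]
      simp
    _ ≤ ENNReal.ofReal (6 * θ * s) := by
      apply ENNReal.ofReal_le_ofReal
      have h1 : Fintype.card ι * (A * (2 * Real.exp (θ ^ 2 / 2)))
          ≤ 2 * Real.exp (θ ^ 2) * (A * (2 * Real.exp (θ ^ 2 / 2))) := by gcongr
      have h2 : 2 * Real.exp (θ ^ 2) * (A * (2 * Real.exp (θ ^ 2 / 2)))
          = 4 * (s / θ) * Real.exp (-(θ ^ 2 / 2)) := by
        have : Real.exp (-(θ ^ 2 / 2)) =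
            Real.exp (θ ^ 2) * Real.exp (-(2 * θ ^ 2)) * Real.exp (θ ^ 2 / 2) := by
          rw [← Real.exp_add, ← Real.exp_add]; ring_nf
        rw [this, hA]; ring
      have h3 : Real.exp (-(θ ^ 2 / 2)) ≤ 1 := Real.exp_le_one_iff.2 (by nlinarith)
      have h4 : s / θ ≤ s * θ := by
        rw [div_le_iff₀ hθ0]; nlinarith [mul_pos hs hθ0]
      have h5 : 0 ≤ s / θ := by positivity
      nlinarith

/-! ### The chaining grids -/

/-- The number `2 ^ 2 ^ k` of intervals into which the `k`-th chaining grid divides `[0, 1]`. -/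
def gridSize (k : ℕ) : ℕ := 2 ^ 2 ^ k

lemma gridSize_pos (k : ℕ) : 0 < gridSize k := by unfold gridSize; positivity

lemma gridSize_succ (k : ℕ) : gridSize (k + 1) = gridSize k * gridSize k := by
  unfold gridSize; rw [pow_succ, pow_mul, sq]

/-- The points `j / 2 ^ 2 ^ k` of `[0, 1]`, over all levels `k`. -/
def gridPoints : Set ℝ := ⋃ k, range fun j : Fin (gridSize k + 1) => (j : ℝ) / gridSize k

lemma gridPoints_countable : gridPoints.Countable :=
  countable_iUnion fun _ => countable_range _

lemma gridPoints_subset : gridPoints ⊆ Icc 0 1 := by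
  intro x hx
  obtain ⟨k, j, rfl⟩ := mem_iUnion.1 hx
  have := gridSize_pos k
  refine ⟨by positivity, ?_⟩
  rw [div_le_one (by positivity)]
  exact_mod_cast Nat.lt_succ_iff.1 j.2

lemma tendsto_gridSize : Tendsto (fun k => (gridSize k : ℝ)) atTop atTop := by
  refine tendsto_natCast_atTop_atTop.comp (tendsto_atTop_mono (fun k => ?_) tendsto_id)
  exact (Nat.lt_two_pow_self.trans Nat.lt_two_pow_self).le

/-- The grid points are dense in `[0, 1]`. -/
lemma exists_gridPoints_mem {x : ℝ} (hx : x ∈ Icc (0 : ℝ) 1) {U : Set ℝ} (hU : U ∈ 𝓝 x) :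
    ∃ y ∈ gridPoints, y ∈ U := by
  have h : Tendsto (fun k => (⌊x * gridSize k⌋₊ : ℝ) / gridSize k) atTop (𝓝 x) :=
    (tendsto_nat_floor_mul_div_atTop hx.1).comp tendsto_gridSize
  obtain ⟨k, hk⟩ := (h.eventually_mem hU).exists
  refine ⟨_, mem_iUnion.2 ⟨k, ⟨⌊x * gridSize k⌋₊, ?_⟩, rfl⟩, hk⟩
  refine Nat.lt_succ_iff.2 (Nat.floor_le_of_le ?_)
  have : (0 : ℝ) ≤ gridSize k := by positivity
  nlinarith [hx.2]

/-! ### Chaining and the entropy integral -/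

/-- Chaining: moving from a grid point to the nearest coarser grid point on its left, the total
displacement of a function is at most the sum of the largest displacements at each level. -/
lemma abs_sub_le_sum_of_grid (g : ℝ → ℝ) (k : ℕ) (j : Fin (gridSize k + 1)) :
    ENNReal.ofReal |g (j / gridSize k) - g 0| ≤
      (⨆ i : Fin 3, ENNReal.ofReal |g ((i : ℝ) / 2) - g 0|) +
        ∑ m ∈ Finset.range k, ⨆ i : Fin (gridSize (m + 1) + 1), ENNReal.ofReal
          |g (i / gridSize (m + 1)) - g ((i / gridSize m : ℕ) / gridSize m)| := by
  induction k with
  | zero =>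
    simp only [Finset.range_zero, Finset.sum_empty, add_zero]
    have : gridSize 0 = 2 := rfl
    refine le_iSup_of_le (⟨j, by have := j.2; omega⟩ : Fin 3) ?_
    simp [this]
  | succ k ih =>
    rw [Finset.sum_range_succ, ← add_assoc]
    have hlt : (j : ℕ) / gridSize k < gridSize k + 1 := by
      refine Nat.lt_succ_iff.2 (Nat.div_le_of_le_mul ?_)
      rw [← gridSize_succ]; exact Nat.lt_succ_iff.1 j.2
    have h1 := ih ⟨j / gridSize k, hlt⟩
    refine le_trans ?_ (add_le_add h1 (le_iSup (fun i : Fin (gridSize (k + 1) + 1) =>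
      ENNReal.ofReal |g (i / gridSize (k + 1)) - g ((i / gridSize k : ℕ) / gridSize k)|) j))
    rw [← ENNReal.ofReal_add (abs_nonneg _) (abs_nonneg _)]
    apply ENNReal.ofReal_le_ofReal
    exact (abs_sub_le _ _ _).trans_eq (add_comm _ _)

lemma abs_grid_sub_le (k j : ℕ) :
    |(j : ℝ) / gridSize (k + 1) - (j / gridSize k : ℕ) / gridSize k| ≤ 1 / gridSize k := by
  have hN := gridSize_pos k
  have hN' : (0 : ℝ) < gridSize k := by exact_mod_cast hN
  have h1 : (j : ℝ) = gridSize k * (j / gridSize k : ℕ) + (j % gridSize k : ℕ) := by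
    exact_mod_cast (Nat.div_add_mod j (gridSize k)).symm
  have h2 : ((j % gridSize k : ℕ) : ℝ) ≤ gridSize k := by
    exact_mod_cast (Nat.mod_lt j hN).le
  have e : (j : ℝ) / gridSize (k + 1) - (j / gridSize k : ℕ) / gridSize k
      = (j % gridSize k : ℕ) / (gridSize k * gridSize k) := by
    rw [gridSize_succ]; push_cast
    rw [div_sub_div _ _ (by positivity) (by positivity), div_eq_div_iff (by positivity)
      (by positivity)]
    generalize ((j % gridSize k : ℕ) : ℝ) = q at *
    generalize ((j / gridSize k : ℕ) : ℝ) = p at *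
    rw [h1]; ring
  rw [e, abs_of_nonneg (by positivity), div_le_div_iff₀ (by positivity) hN']
  nlinarith

/-- Dudley's bound along the grids of mesh `2 ^ (-2 ^ k)`: if the standard deviation of
`X x - X y` is at most `σ |x - y|`, the expected oscillation of `X` on the grid points of `[0, 1]`
is controlled by `∑ 2 ^ (k / 2) σ (2 ^ (-2 ^ k))`. -/
lemma lintegral_iSup_gridPoints_le {Ω : Type*} [MeasurableSpace Ω] {P : Measure Ω}
    [IsProbabilityMeasure P] {X : ℝ → Ω → ℝ} (hX : IsGaussianProcess X P)
    (h0 : ∀ x, ∫ ω, X x ω ∂P = 0) {σ : ℝ → ℝ} (hσ : MonotoneOn σ (Icc 0 1))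
    (hσ0 : 0 ≤ σ 0) (hpos : ∀ x, 0 < x → 0 < σ x)
    (hinc : ∀ x ∈ Icc (0 : ℝ) 1, ∀ y ∈ Icc (0 : ℝ) 1,
      ∫ ω, (X x ω - X y ω) ^ 2 ∂P ≤ σ |x - y| ^ 2) :
    ∫⁻ ω, ⨆ x ∈ gridPoints, ENNReal.ofReal |X x ω - X 0 ω| ∂P ≤
      ENNReal.ofReal (6 * σ 1) +
        ∑' k, ENNReal.ofReal (6 * √(2 ^ (k + 1)) * σ (1 / gridSize k)) := by
  have hinc' : ∀ x ∈ Icc (0 : ℝ) 1, ∀ y ∈ Icc (0 : ℝ) 1, ∀ z ∈ Icc (0 : ℝ) 1, |x - y| ≤ z →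
      ∫ ω, (X x ω - X y ω) ^ 2 ∂P ≤ σ z ^ 2 := by
    intro x hx y hy z hz h
    refine (hinc x hx y hy).trans ?_
    have hm : |x - y| ∈ Icc (0 : ℝ) 1 := ⟨abs_nonneg _, h.trans hz.2⟩
    have h1 := hσ ⟨le_rfl, zero_le_one⟩ hm (abs_nonneg _)
    exact pow_le_pow_left₀ (hσ0.trans h1) (hσ hm hz h) 2
  have hint : ∀ x, Integrable (X x) P := fun x => (hX.hasGaussianLaw_eval x).integrable
  have hmean : ∀ x y, ∫ ω, (X x ω - X y ω) ∂P = 0 := fun x y => by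
    rw [integral_sub (hint x) (hint y), h0, h0, sub_zero]
  have hgm : ∀ k, ∀ j : Fin (gridSize k + 1), (j : ℝ) / gridSize k ∈ Icc (0 : ℝ) 1 :=
    fun k j => gridPoints_subset (mem_iUnion.2 ⟨k, j, rfl⟩)
  have hm : ∀ x y, AEMeasurable (fun ω => ENNReal.ofReal |X x ω - X y ω|) P := fun x y => by
    have h1 := hX.aemeasurable x
    have h2 := hX.aemeasurable y
    fun_prop
  calc ∫⁻ ω, ⨆ x ∈ gridPoints, ENNReal.ofReal |X x ω - X 0 ω| ∂P
      ≤ ∫⁻ ω, ((⨆ i : Fin 3, ENNReal.ofReal |X ((i : ℝ) / 2) ω - X 0 ω|) +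
        ∑' m, ⨆ i : Fin (gridSize (m + 1) + 1), ENNReal.ofReal
          |X (i / gridSize (m + 1)) ω - X ((i / gridSize m : ℕ) / gridSize m) ω|) ∂P := by
        refine lintegral_mono fun ω => iSup₂_le fun x hx => ?_
        obtain ⟨k, j, rfl⟩ := mem_iUnion.1 hx
        refine (abs_sub_le_sum_of_grid (fun x => X x ω) k j).trans ?_
        gcongr
        exact ENNReal.sum_le_tsum _
    _ = (∫⁻ ω, (⨆ i : Fin 3, ENNReal.ofReal |X ((i : ℝ) / 2) ω - X 0 ω|) ∂P) +
        ∑' m, ∫⁻ ω, ⨆ i : Fin (gridSize (m + 1) + 1), ENNReal.ofReal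
          |X (i / gridSize (m + 1)) ω - X ((i / gridSize m : ℕ) / gridSize m) ω| ∂P := by
        rw [lintegral_add_left' (AEMeasurable.iSup fun i => hm _ _),
          lintegral_tsum fun m => AEMeasurable.iSup fun i => hm _ _]
    _ ≤ _ := by
        refine add_le_add ?_ (ENNReal.tsum_le_tsum fun k => ?_)
        · refine (lintegral_iSup_abs_le (P := P) (s := σ 1) (θ := 1)
            (G := fun (i : Fin 3) ω => X ((i : ℝ) / 2) ω - X 0 ω)
            (fun i => hX.hasGaussianLaw_fun_sub) (fun i => hmean _ _) (fun i => ?_)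
            (hpos 1 one_pos) le_rfl ?_).trans (by simp)
          · have h := hgm 0 i
            have e : ((gridSize 0 : ℕ) : ℝ) = 2 := by norm_num [gridSize]
            rw [e] at h
            refine hinc' _ h 0 ⟨le_rfl, zero_le_one⟩ 1 ⟨zero_le_one, le_rfl⟩ ?_
            rw [sub_zero, abs_of_nonneg h.1]; exact h.2
          · have := Real.add_one_le_exp 1
            norm_num at this ⊢; linarith
        · have hk := gridSize_pos k
          have hk' : (1 : ℝ) ≤ gridSize k := by exact_mod_cast hk
          have hz : 1 / (gridSize k : ℝ) ∈ Icc (0 : ℝ) 1 :=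
            ⟨by positivity, by rw [div_le_one (by positivity)]; exact hk'⟩
          refine lintegral_iSup_abs_le (P := P) (s := σ (1 / gridSize k)) (θ := √(2 ^ (k + 1)))
            (G := fun (i : Fin (gridSize (k + 1) + 1)) ω =>
              X (i / gridSize (k + 1)) ω - X ((i / gridSize k : ℕ) / gridSize k) ω)
            (fun i => hX.hasGaussianLaw_fun_sub) (fun i => hmean _ _) (fun i => ?_)
            (hpos _ (by positivity)) ?_ ?_
          · have hlt : (i : ℕ) / gridSize k < gridSize k + 1 := by
              refine Nat.lt_succ_iff.2 (Nat.div_le_of_le_mul ?_)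
              rw [← gridSize_succ]; exact Nat.lt_succ_iff.1 i.2
            exact hinc' _ (hgm (k + 1) i) _ (hgm k ⟨_, hlt⟩) _ hz (abs_grid_sub_le k i)
          · rw [Real.one_le_sqrt]; exact one_le_pow₀ one_le_two
          · rw [Real.sq_sqrt (by positivity)]
            have h2 : (2 : ℝ) ≤ Real.exp 1 := by linarith [Real.add_one_le_exp 1]
            have h3 : ((gridSize (k + 1) : ℕ) : ℝ) ≤ Real.exp (2 ^ (k + 1)) := by
              have := pow_le_pow_left₀ (by norm_num) h2 (2 ^ (k + 1))
              rw [← Real.exp_nat_mul] at this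
              simpa [gridSize] using this
            have h4 : (1 : ℝ) ≤ Real.exp (2 ^ (k + 1)) := Real.one_le_exp (by positivity)
            simp only [Fintype.card_fin]; push_cast; linarith

/-- The dyadic sum in Dudley's bound is dominated by the entropy integral: on
`(2 ^ (-2 ^ (k + 1)), 2 ^ (-2 ^ k))` the weight `1 / (y √(log (1 / y)))` has mass of order
`2 ^ (k / 2)`. -/
lemma tsum_grid_le_lintegral {g : ℝ → ℝ} (hg : MonotoneOn g (Icc 0 1)) (hg0 : 0 ≤ g 0) :
    ∑' k, ENNReal.ofReal (√(2 ^ (k + 2)) * g (1 / gridSize (k + 1))) ≤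
      4 * ∫⁻ y in Ioo (0 : ℝ) (1 / 2), ENNReal.ofReal (g y / (y * √(Real.log (1 / y)))) := by
  set F : ℝ → ℝ≥0∞ := fun y => ENNReal.ofReal (g y / (y * √(Real.log (1 / y)))) with hF
  set J : ℕ → Set ℝ := fun k => Ioo (1 / (gridSize (k + 1) : ℝ)) (1 / gridSize k) with hJ
  have hanti : ∀ m n, m ≤ n → 1 / (gridSize n : ℝ) ≤ 1 / gridSize m := by
    intro m n h
    have := gridSize_pos m
    refine one_div_le_one_div_of_le (by positivity) ?_
    unfold gridSize
    exact_mod_cast Nat.pow_le_pow_right two_pos (Nat.pow_le_pow_right two_pos h)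
  have hdis : Pairwise (Function.onFun Disjoint J) := by
    refine (pairwise_disjoint_on J).2 fun m n hmn => ?_
    refine Set.disjoint_left.2 fun y hy hy' => ?_
    have := hanti (m + 1) n hmn
    exact absurd (hy.1.trans (hy'.2.trans_le this)) (lt_irrefl _)
  have hsub : (⋃ k, J k) ⊆ Ioo (0 : ℝ) (1 / 2) := by
    refine iUnion_subset fun k y hy => ⟨lt_trans (by have := gridSize_pos (k + 1); positivity) hy.1,
      hy.2.trans_le ?_⟩
    refine (hanti 0 k (Nat.zero_le _)).trans (by norm_num [gridSize])
  have hblock : ∀ k, ENNReal.ofReal (√(2 ^ (k + 2)) * g (1 / gridSize (k + 1))) ≤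
      4 * ∫⁻ y in J k, F y := by
    intro k
    have hN := gridSize_pos k
    have hN' : (0 : ℝ) < gridSize k := by exact_mod_cast hN
    have hM' : (0 : ℝ) < gridSize (k + 1) := by exact_mod_cast gridSize_pos (k + 1)
    set α := 1 / (gridSize (k + 1) : ℝ) with hα
    set β := 1 / (gridSize k : ℝ) with hβ
    have hα0 : 0 < α := by positivity
    have hαβ : α ≤ β := hanti _ _ (Nat.le_succ k)
    have hβ1 : β ≤ 1 / 2 := (hanti 0 k (Nat.zero_le _)).trans (by norm_num [gridSize])
    have hlogα : Real.log (1 / α) = 2 ^ (k + 1) * Real.log 2 := by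
      rw [hα, one_div_one_div]; unfold gridSize; push_cast; rw [Real.log_pow]; push_cast; rfl
    have hlogβα : Real.log (β / α) = 2 ^ k * Real.log 2 := by
      rw [hα, hβ, gridSize_succ]; push_cast
      have : 1 / (gridSize k : ℝ) / (1 / (gridSize k * gridSize k)) = gridSize k := by
        field_simp
      rw [this]; unfold gridSize; push_cast; rw [Real.log_pow]; push_cast; rfl
    have hlog2 : 0 < Real.log 2 := Real.log_pos one_lt_two
    set D := √(2 ^ (k + 1) * Real.log 2) with hD
    have hD0 : 0 < D := by positivity
    have hα1 : α ∈ Icc (0 : ℝ) 1 := ⟨hα0.le, by linarith⟩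
    have hgα : 0 ≤ g α := hg0.trans (hg ⟨le_rfl, zero_le_one⟩ hα1 hα0.le)
    have hpt : ∀ y ∈ J k, ENNReal.ofReal (g α / D * y⁻¹) ≤ F y := by
      intro y hy
      have hy0 : 0 < y := hα0.trans hy.1
      have hy1 : y < 1 := by linarith [hy.2]
      apply ENNReal.ofReal_le_ofReal
      have hl0 : 0 < Real.log (1 / y) := Real.log_pos ((one_lt_div hy0).2 hy1)
      have h1 : √(Real.log (1 / y)) ≤ D := by
        rw [hD, ← hlogα]
        exact Real.sqrt_le_sqrt (Real.log_le_log (by positivity)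
          (one_div_le_one_div_of_le hα0 hy.1.le))
      have h2 : g α ≤ g y := hg hα1 ⟨hy0.le, hy1.le⟩ hy.1.le
      have h3 : 0 < √(Real.log (1 / y)) := Real.sqrt_pos.2 hl0
      have h4 : 0 ≤ g y := hgα.trans h2
      calc g α / D * y⁻¹ = g α / (y * D) := by field_simp
        _ ≤ g y / (y * √(Real.log (1 / y))) := by gcongr
    have hint : ∫⁻ y in J k, ENNReal.ofReal (g α / D * y⁻¹) =
        ENNReal.ofReal (g α / D * (2 ^ k * Real.log 2)) := by
      have hii : IntervalIntegrable (fun y : ℝ => g α / D * y⁻¹) volume α β := by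
        refine (ContinuousOn.intervalIntegrable ?_)
        rw [uIcc_of_le hαβ]
        exact continuousOn_const.mul (continuousOn_inv₀.mono fun y hy => (hα0.trans_le hy.1).ne')
      rw [← ofReal_integral_eq_lintegral_ofReal]
      · rw [← integral_Ioc_eq_integral_Ioo, ← intervalIntegral.integral_of_le hαβ,
          intervalIntegral.integral_const_mul, integral_inv_of_pos hα0 (hα0.trans_le hαβ), hlogβα]
      · exact ((intervalIntegrable_iff_integrableOn_Ioc_of_le hαβ).1 hii).mono_set
          Ioo_subset_Ioc_self
      · refine (ae_restrict_iff' measurableSet_Ioo).2 (ae_of_all _ fun y hy => ?_)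
        have : 0 < y := hα0.trans hy.1
        simp only [Pi.zero_apply]
        positivity
    calc ENNReal.ofReal (√(2 ^ (k + 2)) * g α)
        ≤ ENNReal.ofReal (4 * (g α / D * (2 ^ k * Real.log 2))) := by
          apply ENNReal.ofReal_le_ofReal
          have h1 : √(2 ^ (k + 2)) ≤ 4 * (2 ^ k * Real.log 2) / D := by
            rw [le_div_iff₀ hD0, hD, ← Real.sqrt_mul (by positivity)]
            refine Real.sqrt_le_iff.2 ⟨by positivity, ?_⟩
            have := Real.log_two_gt_d9
            have e : (2 : ℝ) ^ (k + 2) * (2 ^ (k + 1) * Real.log 2) =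
              8 * Real.log 2 * (2 ^ k) ^ 2 := by ring
            rw [e]
            have h5 : (0 : ℝ) < (2 ^ k) ^ 2 := by positivity
            have h6 : 8 * Real.log 2 ≤ 16 * Real.log 2 ^ 2 := by nlinarith
            nlinarith
          calc √(2 ^ (k + 2)) * g α ≤ 4 * (2 ^ k * Real.log 2) / D * g α := by gcongr
            _ = _ := by ring
      _ = 4 * ∫⁻ y in J k, ENNReal.ofReal (g α / D * y⁻¹) := by
          rw [hint, ENNReal.ofReal_mul (by norm_num)]; norm_num
      _ ≤ 4 * ∫⁻ y in J k, F y := by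
          gcongr 4 * ?_
          exact setLIntegral_mono' measurableSet_Ioo hpt
  calc _ ≤ ∑' k, 4 * ∫⁻ y in J k, F y := ENNReal.tsum_le_tsum hblock
    _ = 4 * ∫⁻ y in ⋃ k, J k, F y := by
      rw [ENNReal.tsum_mul_left, lintegral_iUnion (fun k => measurableSet_Ioo) hdis]
    _ ≤ _ := by gcongr

/-- Fernique's form of the entropy bound for the oscillation of a Gaussian process. -/
lemma lintegral_iSup_gridPoints_le_entropy {Ω : Type*} [MeasurableSpace Ω] {P : Measure Ω}
    [IsProbabilityMeasure P] {X : ℝ → Ω → ℝ} (hX : IsGaussianProcess X P)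
    (h0 : ∀ x, ∫ ω, X x ω ∂P = 0) {σ : ℝ → ℝ} (hσ : MonotoneOn σ (Icc 0 1))
    (hσ0 : 0 ≤ σ 0) (hpos : ∀ x, 0 < x → 0 < σ x)
    (hinc : ∀ x ∈ Icc (0 : ℝ) 1, ∀ y ∈ Icc (0 : ℝ) 1,
      ∫ ω, (X x ω - X y ω) ^ 2 ∂P ≤ σ |x - y| ^ 2) :
    ∫⁻ ω, ⨆ x ∈ gridPoints, ENNReal.ofReal |X x ω - X 0 ω| ∂P ≤
      ENNReal.ofReal (18 * σ 1) +
        24 * ∫⁻ y in Ioo (0 : ℝ) (1 / 2), ENNReal.ofReal (σ y / (y * √(Real.log (1 / y)))) := by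
  refine (lintegral_iSup_gridPoints_le hX h0 hσ hσ0 hpos hinc).trans ?_
  have h1 : (0 : ℝ) < σ 1 := hpos 1 one_pos
  rw [tsum_eq_zero_add' ENNReal.summable, ← add_assoc]
  refine add_le_add ?_ ?_
  · have h2 : √(2 ^ (0 + 1)) ≤ 2 := Real.sqrt_le_iff.2 (by norm_num)
    have h3 : 0 < σ (1 / gridSize 0) := hpos _ (by norm_num [gridSize])
    have h4 : σ (1 / gridSize 0) ≤ σ 1 :=
      hσ (by norm_num [gridSize]) (by norm_num) (by norm_num [gridSize])
    rw [← ENNReal.ofReal_add (by positivity) (by positivity)]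
    apply ENNReal.ofReal_le_ofReal
    have : √(2 ^ (0 + 1)) * σ (1 / gridSize 0) ≤ 2 * σ 1 := by gcongr
    linarith
  · have e : ∀ k : ℕ, ENNReal.ofReal (6 * √(2 ^ (k + 1 + 1)) * σ (1 / gridSize (k + 1))) =
        6 * ENNReal.ofReal (√(2 ^ (k + 2)) * σ (1 / gridSize (k + 1))) := fun k => by
      rw [mul_assoc, ENNReal.ofReal_mul (by norm_num)]; norm_num
    simp_rw [e]
    rw [ENNReal.tsum_mul_left]
    refine (mul_le_mul_right (tsum_grid_le_lintegral hσ hσ0) 6).trans (le_of_eq ?_)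
    rw [← mul_assoc]; norm_num

/-! ### Second moments -/

/-- The Cauchy–Schwarz inequality for second moments. -/
lemma abs_integral_mul_le {Ω : Type*} [MeasurableSpace Ω] {P : Measure Ω} {U V : Ω → ℝ}
    (hU : MemLp U 2 P) (hV : MemLp V 2 P) {u v : ℝ} (hu : 0 < u) (hv : 0 < v)
    (hUu : ∫ ω, U ω ^ 2 ∂P ≤ u ^ 2) (hVv : ∫ ω, V ω ^ 2 ∂P ≤ v ^ 2) :
    |∫ ω, U ω * V ω ∂P| ≤ u * v := by
  have hUV : Integrable (fun ω => U ω * V ω) P := hU.integrable_mul hV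
  have key : ∀ e : ℝ, e ^ 2 = 1 → -(e * ∫ ω, U ω * V ω ∂P) ≤ u * v := by
    intro e he
    have h : ∫ ω, (v * U ω + e * u * V ω) ^ 2 ∂P = v ^ 2 * (∫ ω, U ω ^ 2 ∂P) +
        (2 * e * u * v) * (∫ ω, U ω * V ω ∂P) + u ^ 2 * ∫ ω, V ω ^ 2 ∂P := by
      have hUV' : Integrable (fun ω => v ^ 2 * U ω ^ 2 + 2 * e * u * v * (U ω * V ω)) P :=
        (hU.integrable_sq.const_mul _).add (hUV.const_mul _)
      rw [← integral_const_mul, ← integral_const_mul, ← integral_const_mul,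
        ← integral_add (hU.integrable_sq.const_mul _) (hUV.const_mul _),
        ← integral_add hUV' (hV.integrable_sq.const_mul _)]
      congr 1 with ω
      linear_combination (u ^ 2 * V ω ^ 2) * he
    have h0 : 0 ≤ ∫ ω, (v * U ω + e * u * V ω) ^ 2 ∂P := integral_nonneg fun ω => sq_nonneg _
    have huv := mul_pos hu hv
    have h1 := mul_le_mul_of_nonneg_left hUu (sq_nonneg v)
    have h2 := mul_le_mul_of_nonneg_left hVv (sq_nonneg u)
    have h3 : 0 ≤ (2 * (u * v)) * (u * v + e * ∫ ω, U ω * V ω ∂P) := by nlinarith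
    have := nonneg_of_mul_nonneg_right h3 (by positivity)
    linarith
  refine abs_le.2 ⟨?_, ?_⟩
  · linarith [key 1 (by norm_num)]
  · linarith [key (-1) (by norm_num)]

/-! ### Regression on one time and small-ball probabilities -/

/-- A centered Gaussian variable of standard deviation at least `v` has a density bounded by
`1 / v`, so it is close to a given point up to an independent random error `W` with probability
at most `2 𝔼 W / v`. -/
lemma measure_abs_sub_le_of_indepFun {Ω : Type*} [MeasurableSpace Ω] {P : Measure Ω}
    [IsProbabilityMeasure P] {Z : Ω → ℝ} {W : Ω → ℝ≥0∞} (hZ : HasGaussianLaw Z P)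
    (h0 : ∫ ω, Z ω ∂P = 0) {v : ℝ} (hv : 0 < v) (hvar : v ^ 2 ≤ ∫ ω, Z ω ^ 2 ∂P)
    (hW : AEMeasurable W P) (hZW : IndepFun Z W P) (z : ℝ) :
    P {ω | ENNReal.ofReal |Z ω - z| ≤ W ω} ≤ ENNReal.ofReal (2 / v) * ∫⁻ ω, W ω ∂P := by
  have hVar : Var[Z; P] = ∫ ω, Z ω ^ 2 ∂P := variance_of_integral_eq_zero hZ.aemeasurable h0
  have hmap := hZ.map_eq_gaussianReal
  rw [h0] at hmap
  set V := Var[Z; P].toNNReal with hV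
  have hVv : v ^ 2 ≤ (V : ℝ) := by
    rw [hV, Real.coe_toNNReal _ (variance_nonneg _ _), hVar]; exact hvar
  have hV0 : V ≠ 0 := by
    intro h
    rw [h, NNReal.coe_zero] at hVv
    have := pow_pos hv 2
    linarith
  have hpdf : ∀ x, gaussianPDF 0 V x ≤ ENNReal.ofReal (1 / v) := by
    intro x
    apply ENNReal.ofReal_le_ofReal
    have h1 : Real.exp (-(x - 0) ^ 2 / (2 * V)) ≤ 1 :=
      Real.exp_le_one_iff.2 (div_nonpos_of_nonpos_of_nonneg (by nlinarith [sq_nonneg x])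
        (by positivity))
    have h2 : v ≤ √(2 * Real.pi * V) := by
      apply Real.le_sqrt_of_sq_le
      nlinarith [Real.pi_gt_three]
    calc gaussianPDFReal 0 V x ≤ (√(2 * Real.pi * V))⁻¹ * 1 := by
          rw [gaussianPDFReal]; gcongr
      _ ≤ 1 / v := by rw [mul_one, ← one_div]; exact one_div_le_one_div_of_le hv h2
  set S : Set (ℝ × ℝ≥0∞) := {p | ENNReal.ofReal |p.1 - z| ≤ p.2} with hS
  have hSm : MeasurableSet S := measurableSet_le (by fun_prop) (by fun_prop)
  have hslice : ∀ w : ℝ≥0∞, P.map Z ((fun x => (x, w)) ⁻¹' S) ≤ ENNReal.ofReal (2 / v) * w := by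
    intro w
    rw [hmap, gaussianReal_apply 0 hV0]
    calc ∫⁻ x in (fun x => (x, w)) ⁻¹' S, gaussianPDF 0 V x
        ≤ ∫⁻ x in (fun x => (x, w)) ⁻¹' S, ENNReal.ofReal (1 / v) := lintegral_mono hpdf
      _ = ENNReal.ofReal (1 / v) * volume ((fun x => (x, w)) ⁻¹' S) := by simp
      _ ≤ ENNReal.ofReal (1 / v) * (2 * w) := by
        gcongr
        rcases eq_or_ne w ⊤ with rfl | hw
        · simp
        · refine (measure_mono (t := Metric.closedBall z w.toReal) fun x hx => ?_).trans ?_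
          · rw [Metric.mem_closedBall, Real.dist_eq]
            exact (ENNReal.ofReal_le_iff_le_toReal hw).1 hx
          · rw [Real.volume_closedBall, ENNReal.ofReal_mul two_pos.le, ENNReal.ofReal_toReal hw]
            simp
      _ = ENNReal.ofReal (2 / v) * w := by
        rw [← mul_assoc]
        congr 1
        rw [show (2 : ℝ≥0∞) = ENNReal.ofReal 2 by simp, ← ENNReal.ofReal_mul (by positivity)]
        congr 1; ring
  have hjoint := (indepFun_iff_map_prod_eq_prod_map_map hZ.aemeasurable hW).1 hZW
  have : IsProbabilityMeasure (P.map Z) := Measure.isProbabilityMeasure_map hZ.aemeasurable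
  have : IsProbabilityMeasure (P.map W) := Measure.isProbabilityMeasure_map hW
  calc P {ω | ENNReal.ofReal |Z ω - z| ≤ W ω}
      = P.map (fun ω => (Z ω, W ω)) S :=
        (Measure.map_apply_of_aemeasurable (hZ.aemeasurable.prodMk hW) hSm).symm
    _ = ∫⁻ w, P.map Z ((fun x => (x, w)) ⁻¹' S) ∂(P.map W) := by
        rw [hjoint, Measure.prod_apply_symm hSm]
    _ ≤ ∫⁻ w, ENNReal.ofReal (2 / v) * w ∂(P.map W) := lintegral_mono hslice
    _ = ENNReal.ofReal (2 / v) * ∫⁻ ω, W ω ∂P := by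
        rw [lintegral_const_mul _ measurable_id', lintegral_map' measurable_id'.aemeasurable hW]

/-- In a Gaussian process, the residuals of the regression on `X t` are independent of `X t`. -/
lemma indepFun_regression_residual {Ω T : Type*} [MeasurableSpace Ω] {P : Measure Ω}
    {X : T → Ω → ℝ} (hX : IsGaussianProcess X P) (h0 : ∀ s, ∫ ω, X s ω ∂P = 0) (t : T)
    {c : T → ℝ} (hc : ∀ s, ∫ ω, X s ω * X t ω ∂P = c s * ∫ ω, X t ω ^ 2 ∂P) :
    IndepFun (X t) (fun ω s => X s ω - c s * X t ω) P := by
  classical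
  have hm := hX.aemeasurable
  have hL : ∀ s, MemLp (X s) 2 P := fun s => (hX.hasGaussianLaw_eval s).memLp_two
  have hP := hX.isProbabilityMeasure
  have hG : IsGaussianProcess (Sum.elim (fun (_ : Unit) => X t)
      (fun s ω => X s ω - c s * X t ω)) P := by
    refine hX.of_isGaussianProcess fun s => ?_
    rcases s with s | s
    · exact ⟨{t}, ContinuousLinearMap.proj ⟨t, by simp⟩, fun ω => by simp⟩
    · exact ⟨{s, t}, ContinuousLinearMap.proj ⟨s, by simp⟩ -
        c s • ContinuousLinearMap.proj ⟨t, by simp⟩, fun ω => by simp⟩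
  have h := hG.indepFun_of_covariance_eq_zero (fun _ => hm t)
    (fun s => (hm s).sub ((hm t).const_mul _)) fun _ s => by
      have e : ∫ ω, (X s ω - c s * X t ω) ∂P = 0 := by
        rw [integral_sub ((hL s).integrable one_le_two)
          (((hL t).integrable one_le_two).const_mul _),
          integral_const_mul, h0, h0]; simp
      have hR : MemLp (fun ω => X s ω - c s * X t ω) 2 P := (hL s).sub ((hL t).const_mul _)
      have hst : Integrable (fun ω => X s ω * X t ω) P := (hL s).integrable_mul (hL t)
      rw [covariance_eq_sub (hL t) hR, h0, zero_mul, sub_zero]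
      have e2 : ∀ ω, (X t * fun ω => X s ω - c s * X t ω) ω =
          X s ω * X t ω - c s * X t ω ^ 2 := fun ω => by simp only [Pi.mul_apply]; ring
      simp_rw [e2]
      rw [integral_sub hst ((hL t).integrable_sq.const_mul _),
        integral_const_mul, hc, sub_self]
  exact h.comp (φ := fun f : Unit → ℝ => f ()) (ψ := id) (measurable_pi_apply _) measurable_id

/-- The hitting estimate for one coordinate, along the grid points. Writing `X x = c x * X 0 + R x`
with `R` independent of `X 0`, the path comes near `z` only if `X 0` is near `z` up to an error
controlled by `sup |R|`. -/
lemma measure_exists_gridPoints_lt_le {Ω : Type*} [MeasurableSpace Ω] {P : Measure Ω}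
    [IsProbabilityMeasure P] {X : ℝ → Ω → ℝ} (hX : IsGaussianProcess X P)
    (h0 : ∀ x, ∫ ω, X x ω ∂P = 0) {σ : ℝ → ℝ} (hσ : MonotoneOn σ (Icc 0 1))
    (hσ0 : 0 ≤ σ 0) (hpos : ∀ x, 0 < x → 0 < σ x)
    (hinc : ∀ x ∈ Icc (0 : ℝ) 1, ∀ y ∈ Icc (0 : ℝ) 1,
      ∫ ω, (X x ω - X y ω) ^ 2 ∂P ≤ σ |x - y| ^ 2)
    {v : ℝ} (hv : 0 < v) (hvar : v ^ 2 ≤ ∫ ω, X 0 ω ^ 2 ∂P) (hσv : σ 1 ≤ v / 2)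
    {z M ε : ℝ} (hz : |z| ≤ M) (hε : 0 < ε) :
    P {ω | ∃ x ∈ gridPoints, |X x ω - z| < ε} ≤ ENNReal.ofReal (2 / v) *
      (ENNReal.ofReal (2 * ε + (2 * M / v + 38) * σ 1) +
        48 * ∫⁻ y in Ioo (0 : ℝ) (1 / 2), ENNReal.ofReal (σ y / (y * √(Real.log (1 / y))))) := by
  have hσ1 : 0 < σ 1 := hpos 1 one_pos
  have hM : 0 ≤ M := (abs_nonneg z).trans hz
  have hL : ∀ x, MemLp (X x) 2 P := fun x => (hX.hasGaussianLaw_eval x).memLp_two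
  have hm : ∀ x, AEMeasurable (X x) P := hX.aemeasurable
  have h01 : (0 : ℝ) ∈ Icc (0 : ℝ) 1 := ⟨le_rfl, zero_le_one⟩
  have hI0 : 0 < ∫ ω, X 0 ω ^ 2 ∂P := (pow_pos hv 2).trans_le hvar
  set w := √(∫ ω, X 0 ω ^ 2 ∂P) with hw
  have hw0 : 0 < w := Real.sqrt_pos.2 hI0
  have hw2 : ∫ ω, X 0 ω ^ 2 ∂P = w ^ 2 := (Real.sq_sqrt hI0.le).symm
  have hvw : v ≤ w := Real.le_sqrt_of_sq_le hvar
  -- The regression coefficient of `X x` on `X 0`; it is close to `1` for `x` in the unit interval.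
  set c : ℝ → ℝ := fun x => (∫ ω, X x ω * X 0 ω ∂P) / w ^ 2 with hc
  have hcw : ∀ x, ∫ ω, X x ω * X 0 ω ∂P = c x * ∫ ω, X 0 ω ^ 2 ∂P := fun x => by
    rw [hw2, hc]; field_simp
  have hc1 : ∀ x ∈ gridPoints, |1 - c x| ≤ σ 1 / w := by
    intro x hx
    have hx1 := gridPoints_subset hx
    have h1 : ∫ ω, (X 0 ω - X x ω) ^ 2 ∂P ≤ σ 1 ^ 2 := by
      refine (hinc 0 h01 x hx1).trans ?_
      have hx2 : |0 - x| ∈ Icc (0 : ℝ) 1 := by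
        rw [zero_sub, abs_neg, abs_of_nonneg hx1.1]; exact hx1
      exact pow_le_pow_left₀ (hσ0.trans (hσ h01 hx2 hx2.1)) (hσ hx2 ⟨zero_le_one, le_rfl⟩ hx2.2) 2
    have h2 := abs_integral_mul_le ((hL 0).sub (hL x)) (hL 0) hσ1 hw0 h1 hw2.le
    have h3 : ∫ ω, (X 0 - X x) ω * X 0 ω ∂P = (1 - c x) * w ^ 2 := by
      have e : ∀ ω, (X 0 - X x) ω * X 0 ω = X 0 ω ^ 2 - X x ω * X 0 ω := fun ω => by
        simp only [Pi.sub_apply]; ring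
      simp_rw [e]
      have hx0 : Integrable (fun ω => X x ω * X 0 ω) P := (hL x).integrable_mul (hL 0)
      rw [integral_sub (hL 0).integrable_sq hx0, hcw, hw2]; ring
    rw [h3, abs_mul, abs_of_nonneg (sq_nonneg w)] at h2
    rw [le_div_iff₀ hw0]
    have : |1 - c x| * w * w ≤ σ 1 * w := by linarith
    exact le_of_mul_le_mul_right this hw0
  set K := 2 * ε + 2 * (σ 1 / v * M) with hK
  have hK0 : 0 ≤ K := by positivity
  set W : Ω → ℝ≥0∞ := fun ω => ENNReal.ofReal K +
    2 * ⨆ x ∈ gridPoints, ENNReal.ofReal |X x ω - c x * X 0 ω| with hW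
  have hWm : AEMeasurable W P := by
    refine AEMeasurable.const_add (AEMeasurable.const_mul ?_ _) _
    refine AEMeasurable.biSup _ gridPoints_countable fun x _ => ?_
    have h1 := hm x
    have h2 := hm 0
    fun_prop
  have hind : IndepFun (X 0) W P := by
    refine (indepFun_regression_residual hX h0 0 hcw).comp (φ := id)
      (ψ := fun f : ℝ → ℝ => ENNReal.ofReal K + 2 * ⨆ x ∈ gridPoints, ENNReal.ofReal |f x|)
      measurable_id ?_
    refine Measurable.const_add (Measurable.const_mul ?_ _) _
    refine Measurable.biSup _ gridPoints_countable fun x _ => ?_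
    fun_prop
  have hsub : {ω | ∃ x ∈ gridPoints, |X x ω - z| < ε} ⊆
      {ω | ENNReal.ofReal |X 0 ω - z| ≤ W ω} := by
    rintro ω ⟨x, hx, hxε⟩
    have hcx := hc1 x hx
    have hle : σ 1 / w ≤ σ 1 / v := by gcongr
    have hhalf : σ 1 / v ≤ 1 / 2 := by rw [div_le_iff₀ hv]; linarith
    have hc2 : 1 / 2 ≤ c x := by linarith [(abs_le.1 (hcx.trans (hle.trans hhalf))).2]
    have h1 : c x * |X 0 ω - z| ≤ |X x ω - z| + |X x ω - c x * X 0 ω| + |1 - c x| * |z| := by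
      have e : c x * (X 0 ω - z) =
          (X x ω - z) - (X x ω - c x * X 0 ω) + (1 - c x) * z := by ring
      rw [← abs_of_nonneg (show 0 ≤ c x by linarith), ← abs_mul, ← abs_mul, e,
        abs_of_nonneg (show 0 ≤ c x by linarith)]
      exact (abs_add_le _ _).trans (by gcongr; exact abs_sub _ _)
    have h2 : |1 - c x| * |z| ≤ σ 1 / v * M :=
      mul_le_mul (hcx.trans hle) hz (abs_nonneg _) (by positivity)
    have h3 : |X 0 ω - z| ≤ K + 2 * |X x ω - c x * X 0 ω| := by
      have := mul_le_mul_of_nonneg_right hc2 (abs_nonneg (X 0 ω - z))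
      rw [hK]; linarith
    have h4 : ENNReal.ofReal |X x ω - c x * X 0 ω| ≤
        ⨆ x ∈ gridPoints, ENNReal.ofReal |X x ω - c x * X 0 ω| :=
      le_iSup₂ (f := fun x (_ : x ∈ gridPoints) => ENNReal.ofReal |X x ω - c x * X 0 ω|) x hx
    calc ENNReal.ofReal |X 0 ω - z|
        ≤ ENNReal.ofReal (K + 2 * |X x ω - c x * X 0 ω|) := ENNReal.ofReal_le_ofReal h3
      _ = ENNReal.ofReal K + 2 * ENNReal.ofReal |X x ω - c x * X 0 ω| := by
        rw [ENNReal.ofReal_add hK0 (by positivity), ENNReal.ofReal_mul two_pos.le]; simp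
      _ ≤ W ω := add_le_add le_rfl (mul_le_mul_right h4 2)
  have hX0 : ∫⁻ ω, ENNReal.ofReal |X 0 ω| ∂P ≤ ENNReal.ofReal w := by
    rw [← ofReal_integral_eq_lintegral_ofReal ((hL 0).integrable one_le_two).abs
      (ae_of_all _ fun ω => abs_nonneg _)]
    apply ENNReal.ofReal_le_ofReal
    have h1 : ∫ ω, |X 0 ω| ∂P ≤ ∫ ω, (w⁻¹ / 2 * X 0 ω ^ 2 + w / 2) ∂P := by
      refine integral_mono ((hL 0).integrable one_le_two).abs
        (((hL 0).integrable_sq.const_mul _).add (integrable_const _)) fun ω => ?_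
      have e : w⁻¹ / 2 * X 0 ω ^ 2 + w / 2 - |X 0 ω| = w⁻¹ / 2 * (|X 0 ω| - w) ^ 2 := by
        rw [← sq_abs (X 0 ω)]; field_simp; ring
      have : 0 ≤ w⁻¹ / 2 * (|X 0 ω| - w) ^ 2 := by positivity
      simp only; linarith
    refine h1.trans (le_of_eq ?_)
    rw [integral_add ((hL 0).integrable_sq.const_mul _) (integrable_const _), integral_const_mul,
      hw2]
    simp only [integral_const, probReal_univ, smul_eq_mul, one_mul]
    field_simp; ring
  have hsup : ∫⁻ ω, ⨆ x ∈ gridPoints, ENNReal.ofReal |X x ω - c x * X 0 ω| ∂P ≤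
      ENNReal.ofReal (19 * σ 1) +
        24 * ∫⁻ y in Ioo (0 : ℝ) (1 / 2), ENNReal.ofReal (σ y / (y * √(Real.log (1 / y)))) := by
    have hpt : ∀ ω, ⨆ x ∈ gridPoints, ENNReal.ofReal |X x ω - c x * X 0 ω| ≤
        (⨆ x ∈ gridPoints, ENNReal.ofReal |X x ω - X 0 ω|) +
          ENNReal.ofReal (σ 1 / w) * ENNReal.ofReal |X 0 ω| := by
      refine fun ω => iSup₂_le fun x hx => ?_
      have h1 : |X x ω - c x * X 0 ω| ≤ |X x ω - X 0 ω| + σ 1 / w * |X 0 ω| := by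
        have e : X x ω - c x * X 0 ω = (X x ω - X 0 ω) + (1 - c x) * X 0 ω := by ring
        rw [e]
        refine (abs_add_le _ _).trans ?_
        rw [abs_mul]
        gcongr
        exact hc1 x hx
      refine (ENNReal.ofReal_le_ofReal h1).trans ?_
      rw [ENNReal.ofReal_add (abs_nonneg _) (by positivity), ENNReal.ofReal_mul (by positivity)]
      gcongr
      exact le_iSup₂ (f := fun x (_ : x ∈ gridPoints) => ENNReal.ofReal |X x ω - X 0 ω|) x hx
    have hm0 : AEMeasurable (fun ω => ENNReal.ofReal |X 0 ω|) P := by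
      have := hm 0
      fun_prop
    refine (lintegral_mono hpt).trans ?_
    rw [lintegral_add_right' _ (hm0.const_mul _), lintegral_const_mul'' _ hm0]
    have h1 : ENNReal.ofReal (σ 1 / w) * ∫⁻ ω, ENNReal.ofReal |X 0 ω| ∂P ≤
        ENNReal.ofReal (σ 1) := by
      refine (mul_le_mul_right hX0 _).trans (le_of_eq ?_)
      rw [← ENNReal.ofReal_mul (by positivity)]
      congr 1; field_simp
    refine (add_le_add (lintegral_iSup_gridPoints_le_entropy hX h0 hσ hσ0 hpos hinc) h1).trans
      (le_of_eq ?_)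
    rw [add_right_comm, ← ENNReal.ofReal_add (by positivity) hσ1.le]
    congr 2; ring
  refine (measure_mono hsub).trans ((measure_abs_sub_le_of_indepFun (hX.hasGaussianLaw_eval 0)
    (h0 0) hv hvar hWm hind z).trans ?_)
  gcongr
  rw [hW, lintegral_add_left measurable_const, lintegral_const_mul' _ _ (by simp)]
  simp only [lintegral_const, measure_univ, mul_one]
  refine (add_le_add le_rfl (mul_le_mul_right hsup 2)).trans (le_of_eq ?_)
  rw [mul_add, ← add_assoc, ← mul_assoc, show (2 : ℝ≥0∞) = ENNReal.ofReal 2 by simp,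
    ← ENNReal.ofReal_mul two_pos.le, ← ENNReal.ofReal_add hK0 (by positivity)]
  congr 2
  · rw [hK]; ring_nf
  · norm_num

/-! ### The scale function -/

lemma IsCommensurate.integral_sub_sq_le {Ω : Type*} [MeasurableSpace Ω] {γ : ℝ → ℝ} {l : ℝ}
    {X : ℝ≥0 → Ω → ℝ} {P : Measure Ω} (h : IsCommensurate γ l X P) (s t : ℝ≥0) :
    ∫ ω, (X t ω - X s ω) ^ 2 ∂P ≤ (√l * γ |(t : ℝ) - s|) ^ 2 :=
  (Real.sqrt_le_iff.1 (h.upper s t)).2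

/-- The standard deviation `γ` is `1`-Lipschitz for the canonical metric, which `√l γ(|t - s|)`
dominates. -/
lemma IsCommensurate.abs_sub_le {Ω : Type*} [MeasurableSpace Ω] {γ : ℝ → ℝ} {l : ℝ}
    {X : ℝ≥0 → Ω → ℝ} {P : Measure Ω} (h : IsCommensurate γ l X P) (hγ : IsScale γ)
    (hX : ∀ t, MemLp (X t) 2 P) {s t : ℝ≥0} (hs : 0 < s) (ht : 0 < t) :
    |γ t - γ s| ≤ √l * γ |(t : ℝ) - s| := by
  have hγs := hγ.pos s hs
  have hγt := hγ.pos t ht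
  refine le_trans ?_ (h.upper s t)
  apply Real.le_sqrt_of_sq_le
  have h1 := abs_integral_mul_le (hX t) (hX s) hγt hγs (h.variance t).le (h.variance s).le
  have hts : Integrable (fun ω => X t ω * X s ω) P := (hX t).integrable_mul (hX s)
  have hd : Integrable (fun ω => X t ω ^ 2 - 2 * (X t ω * X s ω)) P :=
    (hX t).integrable_sq.sub (hts.const_mul 2)
  have h2 : ∫ ω, (X t ω - X s ω) ^ 2 ∂P = γ t ^ 2 - 2 * (∫ ω, X t ω * X s ω ∂P) + γ s ^ 2 := by
    rw [← h.variance, ← h.variance, ← integral_const_mul,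
      ← integral_sub (hX t).integrable_sq (hts.const_mul 2),
      ← integral_add hd (hX s).integrable_sq]
    congr 1 with ω; ring
  rw [h2, sq_abs]
  nlinarith [(abs_le.1 h1).2]

/-- Although `γ` is only assumed continuous near `0`, the relation `𝔼 X t ² = γ t ²` propagates
continuity to `(0, ∞)`. -/
lemma IsCommensurate.continuousOn {Ω : Type*} [MeasurableSpace Ω] {γ : ℝ → ℝ} {l : ℝ}
    {X : ℝ≥0 → Ω → ℝ} {P : Measure Ω} (h : IsCommensurate γ l X P) (hγ : IsScale γ)
    (hX : ∀ t, MemLp (X t) 2 P) : ContinuousOn γ (Ioi 0) := by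
  obtain ⟨x₀, hx₀, hcont, -⟩ := hγ.near_zero
  intro s hs
  refine ContinuousAt.continuousWithinAt ?_
  have h0 : Tendsto γ (𝓝[Icc 0 x₀] 0) (𝓝 0) := by
    have := hcont 0 ⟨le_rfl, hx₀.le⟩
    rwa [ContinuousWithinAt, hγ.map_zero] at this
  have h1 : Tendsto (fun t : ℝ => |t - s|) (𝓝 s) (𝓝[Icc 0 x₀] 0) := by
    refine tendsto_nhdsWithin_iff.2 ⟨?_, ?_⟩
    · have : Continuous fun t : ℝ => |t - s| := by fun_prop
      simpa using this.tendsto s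
    · filter_upwards [Metric.closedBall_mem_nhds s hx₀] with t ht
      exact ⟨abs_nonneg _, by rwa [Metric.mem_closedBall, Real.dist_eq] at ht⟩
  have h2 : Tendsto (fun t : ℝ => √l * γ |t - s|) (𝓝 s) (𝓝 0) := by
    simpa using (h0.comp h1).const_mul (√l)
  rw [ContinuousAt, tendsto_iff_dist_tendsto_zero]
  refine squeeze_zero' (Eventually.of_forall fun t => dist_nonneg) ?_ h2
  filter_upwards [Ioi_mem_nhds hs] with t ht
  have := h.abs_sub_le hγ hX (s := ⟨s, (mem_Ioi.1 hs).le⟩) (t := ⟨t, (mem_Ioi.1 ht).le⟩) hs ht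
  rwa [Real.dist_eq]

/-- For small `u > 0` the infimum defining `scaleInv γ u` is attained, and it is the value at `u` of
the inverse of `γ` near `0`. -/
lemma IsScale.scaleInv_spec {γ : ℝ → ℝ} (hγ : IsScale γ) {h₀ : ℝ} (hh₀ : 0 ≤ h₀)
    (hcont : ContinuousOn γ (Icc 0 h₀)) (hmono : StrictMonoOn γ (Icc 0 h₀)) {u : ℝ} (hu : 0 < u)
    (hu₀ : u ≤ γ h₀) :
    0 < scaleInv γ u ∧ scaleInv γ u ≤ h₀ ∧ γ (scaleInv γ u) = u := by
  have hIVT := intermediate_value_Icc hh₀ hcont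
  rw [hγ.map_zero] at hIVT
  obtain ⟨h, hh, rfl⟩ := hIVT ⟨hu.le, hu₀⟩
  have hpos : 0 < h := by
    rcases hh.1.eq_or_lt with h0 | h0
    · rw [← h0, hγ.map_zero] at hu; exact absurd hu (lt_irrefl _)
    · exact h0
  have hleast : IsLeast {x | 0 ≤ x ∧ γ x = γ h} h := by
    refine ⟨⟨hh.1, rfl⟩, fun x hx => ?_⟩
    by_contra hlt
    push Not at hlt
    exact absurd hx.2 (hmono ⟨hx.1, hlt.le.trans hh.2⟩ hh hlt).ne
  have : scaleInv γ (γ h) = h := hleast.csInf_eq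
  rw [this]
  exact ⟨hpos, hh.2, rfl⟩

/-! ### Hitting estimates on the time axis -/

/-- The one-coordinate hitting estimate on one side of `t`: the sign `e` selects the times
`t + h x` or `t - h x`, with `x` a grid point. -/
lemma measure_exists_oneSided_le {Ω : Type*} [MeasurableSpace Ω] {P : Measure Ω}
    [IsProbabilityMeasure P] {X : ℝ≥0 → Ω → ℝ} (hX : IsGaussianProcess X P)
    (h0 : ∀ t, ∫ ω, X t ω ∂P = 0) {γ : ℝ → ℝ} (hγ : IsScale γ) {l : ℝ} (hl : 1 ≤ l)
    (hcomm : IsCommensurate γ l X P) {h : ℝ} (hh : 0 < h) (hmono : MonotoneOn γ (Icc 0 h))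
    {t : ℝ≥0} (hht : h ≤ t) {r : ℝ} (hr : 0 < r) (hγh : γ h = r * √l) {e : ℝ}
    (he : e = 1 ∨ e = -1) {v : ℝ} (hv : 0 < v) (hvt : v ≤ γ t) (hrv : l * r ≤ v / 2)
    {z M : ℝ} (hz : |z| ≤ M) :
    P {ω | ∃ x ∈ gridPoints, |X (t + e * (h * x)).toNNReal ω - z| < 2 * r} ≤
      ENNReal.ofReal (2 / v) * (ENNReal.ofReal ((4 + (2 * M / v + 38) * l) * r) +
        48 * (ENNReal.ofReal √l * ∫⁻ y in Ioo (0 : ℝ) (1 / 2),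
          ENNReal.ofReal (γ (h * y) / (y * √(Real.log (1 / y)))))) := by
  have hsl : 0 < √l := Real.sqrt_pos.2 (by linarith)
  have hcoe : ∀ x ∈ Icc (0 : ℝ) 1,
      (((t : ℝ) + e * (h * x)).toNNReal : ℝ) = t + e * (h * x) := by
    intro x hx
    apply Real.coe_toNNReal
    have h1 : h * x ≤ h := by nlinarith [hx.2]
    have h2 : 0 ≤ h * x := mul_nonneg hh.le hx.1
    rcases he with rfl | rfl <;> linarith
  have hmem : ∀ x ∈ Icc (0 : ℝ) 1, h * x ∈ Icc 0 h := fun x hx =>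
    ⟨mul_nonneg hh.le hx.1, by nlinarith [hx.2]⟩
  have hσ1 : √l * γ (h * 1) = l * r := by
    rw [mul_one, hγh]; linear_combination r * Real.mul_self_sqrt (show 0 ≤ l by linarith)
  have key := measure_exists_gridPoints_lt_le
    (X := fun x => X ((t : ℝ) + e * (h * x)).toNNReal) (σ := fun x => √l * γ (h * x))
    (hX.comp_right _) (fun x => h0 _)
    (fun x hx y hy hxy => mul_le_mul_of_nonneg_left
      (hmono (hmem x hx) (hmem y hy) (by gcongr)) hsl.le)
    (by simp [hγ.map_zero]) (fun x hx => mul_pos hsl (hγ.pos _ (mul_pos hh hx)))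
    (fun x hx y hy => by
      refine (hcomm.integral_sub_sq_le _ _).trans (le_of_eq ?_)
      rw [hcoe x hx, hcoe y hy]
      have : (t : ℝ) + e * (h * x) - (t + e * (h * y)) = e * (h * (x - y)) := by ring
      rw [this, abs_mul, abs_mul, abs_of_pos hh]
      rcases he with rfl | rfl <;> simp)
    hv (by
      rw [mul_zero, mul_zero, add_zero, Real.toNNReal_coe, hcomm.variance]
      exact pow_le_pow_left₀ hv.le hvt 2)
    (by rw [hσ1]; exact hrv) hz (ε := 2 * r) (by positivity)
  refine key.trans (le_of_eq ?_)
  rw [hσ1, ← lintegral_const_mul' _ _ ENNReal.ofReal_ne_top]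
  congr 3
  · ring
  · congr 1
    ext y
    rw [← ENNReal.ofReal_mul hsl.le, mul_div_assoc]

/-- The paths that pass at distance less than `ε` from `z` at one of the times `t ± h x`, with
`x` a grid point. -/
def nearPaths (t : ℝ≥0) (h z ε : ℝ) : Set (ℝ≥0 → ℝ) :=
  {f | ∃ e ∈ ({1, -1} : Set ℝ), ∃ x ∈ gridPoints, |f (t + e * (h * x)).toNNReal - z| < ε}

lemma measurableSet_nearPaths (t : ℝ≥0) (h z ε : ℝ) : MeasurableSet (nearPaths t h z ε) := by
  have : nearPaths t h z ε = ⋃ e ∈ ({1, -1} : Set ℝ), ⋃ x ∈ gridPoints,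
      {f | |f (t + e * (h * x)).toNNReal - z| < ε} := by
    ext f; simp [nearPaths]
  rw [this]
  refine MeasurableSet.biUnion (Set.toFinite _).countable fun e _ =>
    MeasurableSet.biUnion gridPoints_countable fun x _ => measurableSet_lt ?_ measurable_const
  fun_prop

/-- A continuous vector-valued path that comes near `z` within time `h` of `t` has all its
coordinates in `nearPaths`. -/
lemma mem_nearPaths_of_norm_lt {Ω : Type*} {d : ℕ} {B : Fin d → ℝ≥0 → Ω → ℝ} {ω : Ω}
    (hB : ∀ i, Continuous fun t => B i t ω) {s t : ℝ≥0} {h ε : ℝ} (hh : 0 < h)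
    (hst : |(s : ℝ) - t| ≤ h) {z : EuclideanSpace ℝ (Fin d)} (hs : ‖pathVector B s ω - z‖ < ε)
    (i : Fin d) : (fun t => B i t ω) ∈ nearPaths t h (z i) ε := by
  have hi : |B i s ω - z i| < ε := by
    refine lt_of_le_of_lt ?_ hs
    simpa [pathVector] using PiLp.norm_apply_le (pathVector B s ω - z) i
  have key : ∃ e ∈ ({1, -1} : Set ℝ), (t : ℝ) + e * (h * (|(s : ℝ) - t| / h)) = s := by
    rcases abs_cases ((s : ℝ) - t) with ⟨hc, _⟩ | ⟨hc, _⟩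
    · exact ⟨1, by simp, by rw [hc]; field_simp; ring⟩
    · exact ⟨-1, by simp, by rw [hc]; field_simp; ring⟩
  obtain ⟨e, he, hes⟩ := key
  have hcont : Continuous fun x : ℝ => |B i ((t : ℝ) + e * (h * x)).toNNReal ω - z i| := by
    have h1 : Continuous fun x : ℝ => ((t : ℝ) + e * (h * x)).toNNReal := by fun_prop
    have h2 := (hB i).comp h1
    exact (h2.sub continuous_const).abs
  have hU : {x : ℝ | |B i ((t : ℝ) + e * (h * x)).toNNReal ω - z i| < ε} ∈
      𝓝 (|(s : ℝ) - t| / h) := by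
    refine (isOpen_lt hcont continuous_const).mem_nhds ?_
    rw [mem_ofPred_eq, hes, Real.toNNReal_coe]
    exact hi
  obtain ⟨x, hx, hxU⟩ := exists_gridPoints_mem
    ⟨by positivity, (div_le_one hh).2 hst⟩ hU
  exact ⟨e, he, x, hx, hxU⟩

end GaussianHitting

/-! ### The hitting estimate for the vector process -/

theorem mainTheorem6
    {Ω₀ Ω : Type*} [MeasurableSpace Ω₀] [MeasurableSpace Ω]
    (P₀ : Measure Ω₀) [IsProbabilityMeasure P₀] (P : Measure Ω) [IsProbabilityMeasure P]
    (B₀ : ℝ≥0 → Ω₀ → ℝ) (hB₀ : GaussianHitting.IsCenteredContinuousGaussian B₀ P₀)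
    (γ : ℝ → ℝ) (hγ : GaussianHitting.IsScale γ)
    (l : ℝ) (hl : 1 ≤ l) (hcomm : GaussianHitting.IsCommensurate γ l B₀ P₀)
    (d : ℕ) (B : Fin d → ℝ≥0 → Ω → ℝ) (hB : GaussianHitting.AreIndepCopies B P B₀ P₀)
    (a b : ℝ≥0) (ha : 0 < a) (hab : a < b) (M : ℝ) (hM : 0 < M) :
    ∃ c₂ r₀ : ℝ, 0 < c₂ ∧ 0 < r₀ ∧
      ∀ r ∈ Ioo 0 r₀, ∀ t ∈ Icc a b, ∀ z : EuclideanSpace ℝ (Fin d),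
        (∀ i, z i ∈ Icc (-M) M) →
          P {ω | sInf ((fun s => ‖GaussianHitting.pathVector B s ω - z‖) ''
              (GaussianHitting.deltaBall (GaussianHitting.canonicalMetric B₀ P₀) t r ∩ Icc a b))
                ≤ r} ≤
            ENNReal.ofReal c₂ *
              (ENNReal.ofReal r + GaussianHitting.entropyBound γ l r) ^ d := by
  open GaussianHitting in
  have hl0 : 0 < l := by linarith
  have hsl : 0 < √l := Real.sqrt_pos.2 hl0
  have hsl1 : √l ≤ l := Real.sqrt_le_iff.2 ⟨hl0.le, by nlinarith⟩
  have hL : ∀ t, MemLp (B₀ t) 2 P₀ := fun t => (hB₀.gaussian.hasGaussianLaw_eval t).memLp_two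
  obtain ⟨x₀, hx₀, hcont, hmono⟩ := hγ.near_zero
  have ha' : (0 : ℝ) < a := ha
  have hab' : (a : ℝ) < b := hab
  set h₀ := min x₀ a with hh₀
  have hh₀0 : 0 < h₀ := lt_min hx₀ ha'
  have hh₀x : h₀ ≤ x₀ := min_le_left _ _
  have hh₀a : h₀ ≤ a := min_le_right _ _
  have hIcc : Icc 0 h₀ ⊆ Icc 0 x₀ := Icc_subset_Icc_right hh₀x
  -- `γ` is bounded below away from `0`: this bounds the density of `B₀ t` for `t ∈ I`, and
  -- forces points of `I` that are close for the canonical metric to be close.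
  obtain ⟨m, hm0, hm⟩ : ∃ m > 0, ∀ x ∈ Icc h₀ (b : ℝ), m ≤ γ x := by
    obtain ⟨x, hx, hmin⟩ := isCompact_Icc.exists_isMinOn
      (nonempty_Icc.2 (hh₀a.trans hab'.le))
      ((hcomm.continuousOn hγ hL).mono fun x hx => hh₀0.trans_le hx.1)
    exact ⟨γ x, hγ.pos x (hh₀0.trans_le hx.1), fun y hy => hmin hy⟩
  set A := 4 + (2 * M / m + 38) * l with hA
  have hA0 : 0 < A := by positivity
  set K := 4 / m * (A + 48 * √l) with hK
  have hK0 : 0 < K := by positivity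
  refine ⟨K ^ d, m / (4 * l), by positivity, by positivity, fun r hr t ht z hz => ?_⟩
  obtain ⟨hr0, hr1⟩ := hr
  rw [lt_div_iff₀ (by positivity)] at hr1
  have hrl : r * √l < m := by nlinarith
  have hmh₀ : m ≤ γ h₀ := hm h₀ ⟨le_rfl, hh₀a.trans hab'.le⟩
  obtain ⟨hh0, hhh₀, hγh⟩ := hγ.scaleInv_spec hh₀0.le (hcont.mono hIcc) (hmono.mono hIcc)
    (u := r * √l) (by positivity) (hrl.le.trans hmh₀)
  set h := scaleInv γ (r * √l) with hh
  have hta : (a : ℝ) ≤ t := ht.1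
  have htb : (t : ℝ) ≤ b := ht.2
  set J := ∫⁻ y in Ioo (0 : ℝ) (1 / 2),
    ENNReal.ofReal (γ (h * y) / (y * √(Real.log (1 / y)))) with hJ
  have hclose : ∀ s ∈ deltaBall (canonicalMetric B₀ P₀) t r ∩ Icc a b, |(s : ℝ) - t| ≤ h := by
    rintro s ⟨hs, hsa, hsb⟩
    have hsa' : (a : ℝ) ≤ s := hsa
    have hsb' : (s : ℝ) ≤ b := hsb
    have h1 : γ |(s : ℝ) - t| ≤ r * √l := by
      have := (hcomm.lower t s).trans hs
      rwa [one_div, ← div_eq_inv_mul, div_le_iff₀ hsl] at this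
    have h2 : |(s : ℝ) - t| ≤ b := abs_le.2 ⟨by linarith, by linarith⟩
    by_contra hlt
    push Not at hlt
    rcases le_total h₀ |(s : ℝ) - t| with h3 | h3
    · exact absurd (hm _ ⟨h3, h2⟩) (by linarith)
    · have := hmono ⟨hh0.le, hhh₀.trans hh₀x⟩ ⟨abs_nonneg _, h3.trans hh₀x⟩ hlt
      rw [hγh] at this
      linarith
  -- The two sides of `t` are treated separately, each by the one-sided estimate.
  have hcoord : ∀ i, P₀ ((fun ω t => B₀ t ω) ⁻¹' nearPaths t h (z i) (2 * r)) ≤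
      ENNReal.ofReal K * (ENNReal.ofReal r + entropyBound γ l r) := by
    intro i
    have hone : ∀ e : ℝ, e = 1 ∨ e = -1 →
        P₀ {ω | ∃ x ∈ gridPoints, |B₀ (t + e * (h * x)).toNNReal ω - z i| < 2 * r} ≤
        ENNReal.ofReal (2 / m) * (ENNReal.ofReal (A * r) + 48 * (ENNReal.ofReal √l * J)) :=
      fun e he => measure_exists_oneSided_le hB₀.gaussian hB₀.centered hγ hl hcomm hh0
        (hmono.monotoneOn.mono (Icc_subset_Icc_right (hhh₀.trans hh₀x)))
        (hhh₀.trans (hh₀a.trans hta)) hr0 hγh he hm0 (hm t ⟨hh₀a.trans hta, htb⟩)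
        (by linarith) (abs_le.2 (hz i))
    have hsub : (fun ω t => B₀ t ω) ⁻¹' nearPaths t h (z i) (2 * r) ⊆
        {ω | ∃ x ∈ gridPoints, |B₀ (t + (1 : ℝ) * (h * x)).toNNReal ω - z i| < 2 * r} ∪
        {ω | ∃ x ∈ gridPoints, |B₀ (t + (-1 : ℝ) * (h * x)).toNNReal ω - z i| < 2 * r} := by
      rintro ω ⟨e, he, hx⟩
      rcases he with rfl | rfl
      · exact Or.inl hx
      · exact Or.inr hx
    have hJf : J ≤ entropyBound γ l r := le_add_self
    calc _ ≤ _ := (measure_mono hsub).trans (measure_union_le _ _)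
      _ ≤ 2 * (ENNReal.ofReal (2 / m) *
          (ENNReal.ofReal (A * r) + 48 * (ENNReal.ofReal √l * J))) := by
        rw [two_mul (ENNReal.ofReal (2 / m) * _)]
        exact add_le_add (hone 1 (Or.inl rfl)) (hone (-1) (Or.inr rfl))
      _ = ENNReal.ofReal (4 / m) * (ENNReal.ofReal A * ENNReal.ofReal r +
          ENNReal.ofReal (48 * √l) * J) := by
        have h4 : ENNReal.ofReal (4 / m) = 2 * ENNReal.ofReal (2 / m) := by
          rw [show 4 / m = 2 * (2 / m) by ring, ENNReal.ofReal_mul two_pos.le]; simp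
        have h48 : ENNReal.ofReal (48 * √l) = 48 * ENNReal.ofReal √l := by
          rw [ENNReal.ofReal_mul (by norm_num)]; simp
        rw [← ENNReal.ofReal_mul hA0.le, h4, h48, mul_assoc, mul_assoc 48]
      _ ≤ ENNReal.ofReal (4 / m) *
          (ENNReal.ofReal (A + 48 * √l) * (ENNReal.ofReal r + entropyBound γ l r)) := by
        rw [mul_add (ENNReal.ofReal (A + 48 * √l))]
        gcongr
        · linarith
        · linarith
      _ = _ := by rw [← mul_assoc, ← ENNReal.ofReal_mul (by positivity)]
  have hae : ∀ᵐ ω ∂P, ∀ i, Continuous fun t => B i t ω := ae_all_iff.2 hB.continuous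
  -- The sublevel `r` is relaxed to the strict bound `2 r`, an open condition on the time, so that
  -- it can be tested at grid points and no attainment of the infimum is needed.
  calc P {ω | sInf ((fun s => ‖pathVector B s ω - z‖) ''
          (deltaBall (canonicalMetric B₀ P₀) t r ∩ Icc a b)) ≤ r}
      ≤ P (⋂ i ∈ Finset.univ, (fun ω t => B i t ω) ⁻¹' nearPaths t h (z i) (2 * r)) := by
        refine measure_mono_ae ?_
        filter_upwards [hae] with ω hω hinf
        have htmem : t ∈ deltaBall (canonicalMetric B₀ P₀) t r ∩ Icc a b := by
          refine ⟨?_, ht⟩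
          simp [deltaBall, canonicalMetric, hr0.le]
        have hlt : sInf ((fun s => ‖pathVector B s ω - z‖) ''
          (deltaBall (canonicalMetric B₀ P₀) t r ∩ Icc a b)) < 2 * r :=
          lt_of_le_of_lt hinf (by linarith)
        obtain ⟨_, ⟨s, hs, rfl⟩, hsr⟩ := exists_lt_of_csInf_lt (Set.Nonempty.image _ ⟨t, htmem⟩) hlt
        exact mem_iInter₂.2 fun i _ => mem_nearPaths_of_norm_lt hω hh0 (hclose s hs) hsr i
    _ = ∏ i, P ((fun ω t => B i t ω) ⁻¹' nearPaths t h (z i) (2 * r)) :=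
        hB.indep.measure_inter_preimage_eq_mul _
          fun i _ => measurableSet_nearPaths t h (z i) (2 * r)
    _ = ∏ i, P₀ ((fun ω t => B₀ t ω) ⁻¹' nearPaths t h (z i) (2 * r)) :=
        Finset.prod_congr rfl fun i _ =>
          (hB.identDistrib i).measure_mem_eq (measurableSet_nearPaths t h (z i) (2 * r))
    _ ≤ ∏ _i : Fin d, ENNReal.ofReal K * (ENNReal.ofReal r + entropyBound γ l r) :=
        Finset.prod_le_prod' fun i _ => hcoord i
    _ = _ := by
        rw [Finset.prod_const, Finset.card_univ, Fintype.card_fin, mul_pow,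
          ENNReal.ofReal_pow hK0.le]
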